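/- **Theorem 5.** Let $\beta,\gamma>0$, $h_b\ge 0$, $T_{\max}\ge 0$. A tethered UAV is launched at height $h_b$ above the origin of the plane, with a tether of length at most $T_{\max}$. The locations $\{x_i\}$ of the surrounding buildings form a homogeneous Poisson point process in $\mathbb{R}^2$ with density $\beta$. Their heights $h_{x_i}$ are i.i.d., independent of the locations, and Rayleigh distributed with parameter $\gamma$, in the sense that $\mathbb{P}(h_{x_i}>u)=\exp(-u^2/\gamma^2)$ for $u\ge 0$. An inclination angle $\theta\in[0,\pi/2)$ is clear if every building at distance $L=|x_i|\le T_{\max}\cos\theta$ has height less than $h_b+L\tan\theta$; the minimum inclination angle $\theta_{\min}$ is the infimum of the clear angles ($\pi/2$ if there are none). Then $\mathbb{E}[h_{x_i}]=\frac{\sqrt{\pi}}{2}\gamma$ for every $i$, $\theta_{\min}$ is a random variable, and for every $0<\theta<\frac{\pi}{2}$ $$\mathbb{P}(\theta_{\min}\le\theta)=\exp\Bigg(\frac{-\pi\beta\gamma}{\tan^2\theta}\Bigg(\gamma\left[\exp\left(-\frac{h_b^2}{\gamma^2}\right)-\exp\left(-\frac{(h_b+T_{\max}\sin\theta)^2}{\gamma^2}\right)\right]-h_b\left[\Gamma\left(\tfrac12,\frac{(h_b+T_{\max}\sin\theta)^2}{\gamma^2}\right)-\Gamma\left(\tfrac12,\frac{h_b^2}{\gamma^2}\right)\right]\Bigg)\Bigg),$$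 where $\Gamma(s,x)=\int_0^x t^{s-1}e^{-t}\,dt$ is the lower incomplete Gamma function. -/

import Mathlib

open MeasureTheory ProbabilityTheory
open scoped Real NNReal ENNReal

noncomputable section

namespace Tether

/-- The horizontal plane, with the Euclidean distance. -/
abbrev Plane : Type := EuclideanSpace ℝ (Fin 2)

/-- The number of points, counted with multiplicity, that the configuration `x` has in `B`. -/
def pointCount {E : Type*} (x : ℕ → E) (B : Set E) : ℕ∞ := {i : ℕ | x i ∈ B}.encard

/-- The random points `X 0, X 1, …` form a Poisson point process with intensity measure `μ` (of
infinite total mass): the number of points in a measurable set of finite intensity is Poisson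
distributed with that intensity as its mean, and the numbers of points in finitely many pairwise
disjoint such sets are independent. -/
structure IsPoissonPointProcess {Ω E : Type*} [MeasurableSpace Ω] [MeasurableSpace E]
    (P : Measure Ω) (μ : Measure E) (X : ℕ → Ω → E) : Prop where
  measurable : ∀ i, Measurable (X i)
  count_law : ∀ B : Set E, MeasurableSet B → μ B ≠ ∞ → ∀ k : ℕ,
    P {ω | pointCount (fun i => X i ω) B = (k : ℕ∞)} = poissonMeasure (μ B).toNNReal {k}
  count_indep : ∀ (n : ℕ) (B : Fin n → Set E), (∀ j, MeasurableSet (B j)) →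
    (∀ j, μ (B j) ≠ ∞) → Pairwise (fun j k => Disjoint (B j) (B k)) →
    iIndepFun (fun j ω => pointCount (fun i => X i ω) (B j)) P

/-- The Rayleigh distribution with scale `σ`, i.e. with density `u / σ² · exp (-u² / (2σ²))` on
`[0, ∞)`. -/
def rayleighMeasure (σ : ℝ) : Measure ℝ :=
  volume.withDensity fun u =>
    ENNReal.ofReal (if 0 ≤ u then u / σ ^ 2 * Real.exp (-u ^ 2 / (2 * σ ^ 2)) else 0)

/-- The lower incomplete Gamma function `∫₀ˣ t ^ (s - 1) e ^ (-t) dt`. -/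
def lowerIncompleteGamma (s x : ℝ) : ℝ :=
  ∫ t in (0 : ℝ)..x, t ^ (s - 1) * Real.exp (-t)

/-- A tether of length `T`, launched above the origin at height `hb` with inclination angle `θ`,
passes strictly above all buildings it can reach (in whatever horizontal direction it points):
every building at horizontal distance `L ≤ T cos θ` has height less than `hb + L tan θ`.
Building `i` stands at `x i` and has height `h i`. -/
def IsClearAngle (hb T : ℝ) (x : ℕ → Plane) (h : ℕ → ℝ) (θ : ℝ) : Prop :=
  ∀ i, ‖x i‖ ≤ T * Real.cos θ → h i < hb + ‖x i‖ * Real.tan θ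

/-- The minimum inclination angle of the tether: the infimum of the angles in `[0, π/2)` that clear
all buildings (and `π/2` if there is no such angle). -/
def minInclination (hb T : ℝ) (x : ℕ → Plane) (h : ℕ → ℝ) : ℝ :=
  sInf (insert (π / 2) {θ | θ ∈ Set.Ico 0 (π / 2) ∧ IsClearAngle hb T x h θ})

end Tether

end

/-!
Write `R = T cos θ` and `τ = tan θ`. The angle `θ` is clear exactly when no building in the closed
disc of radius `R` has height at least `hb + L τ`, where `L` is its distance from the origin. The
buildings that are too high form an independent thinning of the Poisson process, so there is none of
them with probability `exp (-m)`, where `m` is their expected number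
`2 π β ∫₀ᴿ r exp (-(hb + r τ)² / γ²) dr`.

The void probability is `IsPoissonPointProcess.measureReal_forall_mark_lt`. It is proved from the
laws and the independence of the counts alone. Given the locations, the probability that all marks
in `B` lie below their thresholds is a finite product of values `g (x i)` over the points in `B`
(`measure_forall_mark_lt_eq_lintegral`, `measure_forall_mark_lt_eq_prod`). Rounding `g` to multiples
of `1 / n` makes this a product of powers `c ^ N` of counts of disjoint sets, whose expectation is a
product of Poisson generating functions
(`IsPoissonPointProcess.lintegral_prod_pow_pointCount`); the rounding error vanishes as `n → ∞`.

The integral `m` is evaluated in polar coordinates (`setIntegral_closedBall_fun_norm`), and by an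
explicit primitive that involves the incomplete Gamma function
(`integral_mul_exp_neg_affine_sq`).

Clearness is monotone in the angle (`IsClearAngle.mono`). Hence the event `θ_min ≤ θ` contains the
event that `θ` is clear and lies in the event that `φ` is clear, for every `φ > θ`. As the closed
form is continuous in the angle, both bounds give the same probability. Monotonicity also lets
rational angles decide whether `θ_min < a`, which makes `θ_min` measurable.
-/

namespace Tether

/-! ### Counts of a Poisson point process -/

theorem le_pointCount_iff {E : Type*} (x : ℕ → E) (B : Set E) (k : ℕ) :
    (k : ℕ∞) ≤ pointCount x B ↔ ∃ t : Finset ℕ, t.card = k ∧ ∀ i ∈ t, x i ∈ B := by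
  unfold pointCount
  constructor
  · intro h
    obtain ⟨t, hts, htk⟩ := Set.exists_subset_encard_eq h
    have hfin : t.Finite := Set.finite_of_encard_eq_coe htk
    refine ⟨hfin.toFinset, ?_, fun i hi => hts (by simpa using hi)⟩
    rw [hfin.encard_eq_coe_toFinset_card] at htk
    exact_mod_cast htk
  · rintro ⟨t, rfl, ht⟩
    rw [← Set.encard_coe_eq_coe_finsetCard]
    exact Set.encard_le_encard fun i hi => ht i hi

section Counts

variable {Ω E : Type*} [MeasurableSpace Ω] [MeasurableSpace E] {P : Measure Ω} {μ : Measure E}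
  {X : ℕ → Ω → E}

theorem measurable_pointCount (hX : ∀ i, Measurable (X i)) {B : Set E} (hB : MeasurableSet B) :
    Measurable fun ω => pointCount (fun i => X i ω) B := by
  have hle : ∀ k : ℕ, MeasurableSet {ω | (k : ℕ∞) ≤ pointCount (fun i => X i ω) B} := by
    intro k
    simp only [le_pointCount_iff]
    have : {ω | ∃ t : Finset ℕ, t.card = k ∧ ∀ i ∈ t, X i ω ∈ B}
        = ⋃ t : Finset ℕ, ⋃ _ : t.card = k, ⋂ i ∈ t, X i ⁻¹' B := by
      ext ω; simp
    rw [this]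
    exact .iUnion fun t => .iUnion fun _ => t.measurableSet_biInter fun i _ => hX i hB
  refine measurable_to_countable' fun n => ?_
  induction n using ENat.recTopCoe with
  | top =>
    have : (fun ω => pointCount (fun i => X i ω) B) ⁻¹' {⊤}
        = ⋂ k : ℕ, {ω | (k : ℕ∞) ≤ pointCount (fun i => X i ω) B} := by
      ext ω
      simp [ENat.eq_top_iff_forall_ge]
    rw [this]
    exact .iInter hle
  | coe n =>
    have : (fun ω => pointCount (fun i => X i ω) B) ⁻¹' {(n : ℕ∞)}
        = {ω | (n : ℕ∞) ≤ pointCount (fun i => X i ω) B} \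
          {ω | ((n + 1 : ℕ) : ℕ∞) ≤ pointCount (fun i => X i ω) B} := by
      ext ω
      simp only [Set.mem_preimage, Set.mem_singleton_iff, Set.mem_sdiff, Set.mem_ofPred_eq, not_le]
      rw [Nat.cast_add, Nat.cast_one, ENat.lt_natCast_add_one_iff, and_comm, le_antisymm_iff]
    rw [this]
    exact (hle n).diff (hle (n + 1))

/-- A set of finite intensity almost surely contains only finitely many points: the probabilities of
the finite counts already sum to `1`. -/
theorem IsPoissonPointProcess.ae_pointCount_ne_top [IsProbabilityMeasure P]
    (hX : IsPoissonPointProcess P μ X) {B : Set E} (hB : MeasurableSet B) (hμB : μ B ≠ ∞) :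
    ∀ᵐ ω ∂P, pointCount (fun i => X i ω) B ≠ ⊤ := by
  have hN := measurable_pointCount hX.measurable hB
  have hmeas : ∀ k : ℕ, MeasurableSet {ω | pointCount (fun i => X i ω) B = (k : ℕ∞)} :=
    fun k => hN (measurableSet_singleton (k : ℕ∞))
  have h1 : P (⋃ k : ℕ, {ω | pointCount (fun i => X i ω) B = (k : ℕ∞)}) = 1 := by
    rw [measure_iUnion _ hmeas]
    · simp_rw [hX.count_law B hB hμB]
      have := measure_iUnion (μ := poissonMeasure (μ B).toNNReal) (f := fun k : ℕ => {k})
        (fun i j hij => by simpa using hij) (fun i => measurableSet_singleton i)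
      rw [← this, Set.iUnion_of_singleton, measure_univ]
    · intro i j hij
      refine Set.disjoint_left.2 fun ω hi hj => hij ?_
      simp only [Set.mem_ofPred_eq] at hi hj
      exact_mod_cast hi.symm.trans hj
  rw [← prob_compl_eq_zero_iff (MeasurableSet.iUnion hmeas)] at h1
  refine measure_mono_null (fun ω hω => ?_) h1
  simp only [Set.mem_compl_iff, Set.mem_ofPred_eq, not_not] at hω
  simp [hω]

/-- The probability generating function of the number of points in `B`. -/
theorem IsPoissonPointProcess.lintegral_pow_pointCount [IsProbabilityMeasure P]
    (hX : IsPoissonPointProcess P μ X) {B : Set E} (hB : MeasurableSet B) (hμB : μ B ≠ ∞)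
    {c : ℝ} (hc : 0 ≤ c) :
    ∫⁻ ω, ENNReal.ofReal c ^ (pointCount (fun i => X i ω) B).toNat ∂P
      = ENNReal.ofReal (Real.exp (-(μ.real B * (1 - c)))) := by
  have hN := measurable_pointCount hX.measurable hB
  have hN' : Measurable fun ω => (pointCount (fun i => X i ω) B).toNat :=
    (Measurable.of_discrete (f := ENat.toNat)).comp hN
  have hmap : P.map (fun ω => (pointCount (fun i => X i ω) B).toNat)
      = poissonMeasure (μ B).toNNReal := by
    refine Measure.ext_of_singleton fun k => ?_
    rw [Measure.map_apply hN' (measurableSet_singleton k), ← hX.count_law B hB hμB k]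
    refine measure_congr ?_
    filter_upwards [hX.ae_pointCount_ne_top hB hμB] with ω hω
    refine propext ?_
    change (pointCount (fun i => X i ω) B).toNat = k ↔ pointCount (fun i => X i ω) B = k
    lift pointCount (fun i => X i ω) B to ℕ using hω with m
    simp
  rw [← lintegral_map (f := fun n : ℕ => ENNReal.ofReal c ^ n) (Measurable.of_discrete) hN', hmap,
    lintegral_countable']
  simp_rw [poissonMeasure_singleton]
  have hm : (((μ B).toNNReal : ℝ≥0) : ℝ) = μ.real B := rfl
  rw [hm]
  have hs : HasSum (fun n : ℕ => c ^ n * (Real.exp (-μ.real B) * μ.real B ^ n / n.factorial))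
      (Real.exp (-(μ.real B * (1 - c)))) := by
    have := (NormedSpace.expSeries_div_hasSum_exp (μ.real B * c)).mul_left (Real.exp (-μ.real B))
    rw [← Real.exp_eq_exp_ℝ, ← Real.exp_add] at this
    convert! this using 1
    · ext n; rw [mul_pow]; ring
    · congr 1; ring
  rw [← hs.tsum_eq, ENNReal.ofReal_tsum_of_nonneg (fun n => by positivity) hs.summable]
  refine tsum_congr fun n => ?_
  rw [← ENNReal.ofReal_pow hc, ← ENNReal.ofReal_mul (by positivity)]

theorem IsPoissonPointProcess.lintegral_prod_pow_pointCount [IsProbabilityMeasure P]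
    (hX : IsPoissonPointProcess P μ X) {n : ℕ} {B : Fin n → Set E}
    (hB : ∀ j, MeasurableSet (B j)) (hμB : ∀ j, μ (B j) ≠ ∞)
    (hdisj : Pairwise fun j k => Disjoint (B j) (B k)) {c : Fin n → ℝ} (hc : ∀ j, 0 ≤ c j) :
    ∫⁻ ω, ∏ j, ENNReal.ofReal (c j) ^ (pointCount (fun i => X i ω) (B j)).toNat ∂P
      = ENNReal.ofReal (Real.exp (-∑ j, μ.real (B j) * (1 - c j))) := by
  have hind := (hX.count_indep n B hB hμB hdisj).comp
    (fun j (m : ℕ∞) => ENNReal.ofReal (c j) ^ m.toNat) (fun j => Measurable.of_discrete)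
  have := lintegral_prod_eq_prod_lintegral_of_indepFun Finset.univ _ hind
    (fun j => Measurable.of_discrete.comp (measurable_pointCount hX.measurable (hB j)))
  simp only [Function.comp_apply] at this
  rw [this]
  simp_rw [fun j => hX.lintegral_pow_pointCount (hB j) (hμB j) (hc j)]
  rw [← ENNReal.ofReal_prod_of_nonneg (fun j _ => (Real.exp_pos _).le), ← Real.exp_sum,
    Finset.sum_neg_distrib]

end Counts

/-! ### Void probability of a marked Poisson point process -/

/-- For frozen locations, independence of the marks turns the probability into a product over the
points in `B`. -/
theorem measure_forall_mark_lt_eq_prod {Ω E : Type*} [MeasurableSpace Ω] {P : Measure Ω}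
    {H : ℕ → Ω → ℝ} {ν : Measure ℝ} {f : E → ℝ} {B : Set E} (hH : ∀ i, Measurable (H i))
    (hH_law : ∀ i, P.map (H i) = ν) (hH_indep : iIndepFun H P) {x : ℕ → E} {S : Finset ℕ}
    (hS : ∀ i, i ∈ S ↔ x i ∈ B) :
    P {ω | ∀ i, x i ∈ B → H i ω < f (x i)} = ∏ i ∈ S, ν (Set.Iio (f (x i))) := by
  have h1 : {ω | ∀ i, x i ∈ B → H i ω < f (x i)} = ⋂ i ∈ S, H i ⁻¹' Set.Iio (f (x i)) := by
    ext ω; simp [hS]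
  rw [h1, hH_indep.measure_inter_preimage_eq_mul S (fun i _ => measurableSet_Iio)]
  refine Finset.prod_congr rfl fun i _ => ?_
  rw [← hH_law i, Measure.map_apply (hH i) measurableSet_Iio]

/-- A product over the points in `B` of a weight that is constant on the cells of a finite partition
of `B` depends only on the counts of the cells. -/
theorem prod_eq_prod_pow_pointCount {E M : Type*} [CommMonoid M] {n : ℕ} {B : Set E}
    {C : Fin n → Set E} (hC : B = ⋃ j, C j) (hdisj : Pairwise fun j k => Disjoint (C j) (C k))
    (c : Fin n → M) {x : ℕ → E} {S : Finset ℕ} (hS : ∀ i, i ∈ S ↔ x i ∈ B) {φ : ℕ → M}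
    (hφ : ∀ i j, x i ∈ C j → φ i = c j) :
    ∏ i ∈ S, φ i = ∏ j, c j ^ (pointCount x (C j)).toNat := by
  classical
  have hex : ∀ i ∈ S, ∃ j, x i ∈ C j := fun i hi => by
    have := (hS i).1 hi
    rw [hC] at this
    exact Set.mem_iUnion.1 this
  have hcount : ∀ j, (pointCount x (C j)).toNat = (S.filter fun i => x i ∈ C j).card := by
    intro j
    have : {i | x i ∈ C j} = ((S.filter fun i => x i ∈ C j : Finset ℕ) : Set ℕ) := by
      ext i
      simp only [Set.mem_ofPred_eq, Finset.coe_filter, iff_and_self, hS, hC]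
      exact fun h => Set.mem_iUnion.2 ⟨j, h⟩
    rw [pointCount, this, Set.encard_coe_eq_coe_finsetCard]
    simp
  simp_rw [hcount, ← Finset.prod_const, Finset.prod_filter]
  rw [Finset.prod_comm]
  refine Finset.prod_congr rfl fun i hi => ?_
  obtain ⟨j, hj⟩ := hex i hi
  rw [Finset.prod_eq_single j, if_pos hj, hφ i j hj]
  · intro k _ hkj
    exact if_neg fun hk => Set.disjoint_left.1 (hdisj hkj) hk hj
  · simp

section Marks

variable {Ω E : Type*} [MeasurableSpace Ω] [MeasurableSpace E] {P : Measure Ω} {μ : Measure E}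
  {X : ℕ → Ω → E} {H : ℕ → Ω → ℝ} {ν : Measure ℝ} {f : E → ℝ} {B : Set E}

theorem measurableSet_forall_mark_lt (hf : Measurable f) (hB : MeasurableSet B) :
    MeasurableSet {p : (ℕ → E) × (ℕ → ℝ) | ∀ i, p.1 i ∈ B → p.2 i < f (p.1 i)} := by
  have hx : ∀ i, Measurable fun p : (ℕ → E) × (ℕ → ℝ) => p.1 i :=
    fun i => (measurable_pi_apply i).comp measurable_fst
  have hh : ∀ i, Measurable fun p : (ℕ → E) × (ℕ → ℝ) => p.2 i :=
    fun i => (measurable_pi_apply i).comp measurable_snd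
  have : {p : (ℕ → E) × (ℕ → ℝ) | ∀ i, p.1 i ∈ B → p.2 i < f (p.1 i)}
      = ⋂ i, ((fun p : (ℕ → E) × (ℕ → ℝ) => p.1 i) ⁻¹' B)ᶜ ∪
          {p | p.2 i < f (p.1 i)} := by
    ext p
    simp [imp_iff_not_or]
  rw [this]
  exact .iInter fun i => ((hx i) hB).compl.union (measurableSet_lt (hh i) (hf.comp (hx i)))

/-- Since marks and locations are independent, the locations may be frozen while the marks are
averaged. -/
theorem measure_forall_mark_lt_eq_lintegral [IsProbabilityMeasure P] (hX : ∀ i, Measurable (X i))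
    (hH : ∀ i, Measurable (H i)) (hXH : IndepFun (fun ω i => X i ω) (fun ω i => H i ω) P)
    (hf : Measurable f) (hB : MeasurableSet B) :
    P {ω | ∀ i, X i ω ∈ B → H i ω < f (X i ω)}
      = ∫⁻ ω, P {ω' | ∀ i, X i ω ∈ B → H i ω' < f (X i ω)} ∂P := by
  have hXm : Measurable fun ω i => X i ω := measurable_pi_lambda _ hX
  have hHm : Measurable fun ω i => H i ω := measurable_pi_lambda _ hH
  have hS := measurableSet_forall_mark_lt hf hB
  have hprod := (indepFun_iff_map_prod_eq_prod_map_map hXm.aemeasurable hHm.aemeasurable).1 hXH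
  have : IsProbabilityMeasure (P.map fun ω i => H i ω) :=
    Measure.isProbabilityMeasure_map hHm.aemeasurable
  calc P {ω | ∀ i, X i ω ∈ B → H i ω < f (X i ω)}
      = P.map (fun ω => (fun i => X i ω, fun i => H i ω))
          {p : (ℕ → E) × (ℕ → ℝ) | ∀ i, p.1 i ∈ B → p.2 i < f (p.1 i)} := by
        rw [Measure.map_apply (hXm.prodMk hHm) hS]; rfl
    _ = ∫⁻ ω, P {ω' | ∀ i, X i ω ∈ B → H i ω' < f (X i ω)} ∂P := by
        rw [hprod, Measure.prod_apply hS,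
          lintegral_map (measurable_measure_prodMk_left hS) hXm]
        refine lintegral_congr fun ω => ?_
        rw [Measure.map_apply hHm (measurable_prodMk_left hS)]
        rfl

/-- **Void probability of an independently marked Poisson process.**  The points of `B` whose mark
reaches the threshold `f` at their location are a thinning of the process, so there is none of them
with probability `exp (-m)`, where `m` is the expected number of such points.

The acceptance probability `g y = ν (-∞, f y)` is rounded down and up to multiples of `1 / n`. For
each rounding the probability is computed exactly from the generating functions of the counts in the
level sets of `g`; the two exponents differ from the claimed one by at most `μ B / n`. -/
theorem IsPoissonPointProcess.measureReal_forall_mark_lt [IsProbabilityMeasure P]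
    [IsProbabilityMeasure ν] (hX : IsPoissonPointProcess P μ X) (hH : ∀ i, Measurable (H i))
    (hH_law : ∀ i, P.map (H i) = ν) (hH_indep : iIndepFun H P)
    (hXH : IndepFun (fun ω i => X i ω) (fun ω i => H i ω) P)
    (hf : Measurable f) (hB : MeasurableSet B) (hμB : μ B ≠ ∞) :
    P.real {ω | ∀ i, X i ω ∈ B → H i ω < f (X i ω)}
      = Real.exp (-∫ y in B, (1 - ν.real (Set.Iio (f y))) ∂μ) := by
  set g : E → ℝ := fun y => ν.real (Set.Iio (f y)) with hg
  have hg0 : ∀ y, 0 ≤ g y := fun y => measureReal_nonneg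
  have hg1 : ∀ y, g y ≤ 1 := fun y => measureReal_le_one
  have hgm : Measurable g := by
    have hmono : Monotone fun u : ℝ => ν.real (Set.Iio u) := fun a b hab =>
      measureReal_mono (Set.Iio_subset_Iio hab)
    exact hmono.measurable.comp hf
  have hgν : ∀ y, ν (Set.Iio (f y)) = ENNReal.ofReal (g y) := fun y => by
    rw [hg, ofReal_measureReal]
  have : IsFiniteMeasure (μ.restrict B) := ⟨by simpa using hμB.lt_top⟩
  have hint : Integrable (fun y => 1 - g y) (μ.restrict B) := by
    refine (integrable_const (1 : ℝ)).mono' (by fun_prop) (.of_forall fun y => ?_)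
    rw [Real.norm_eq_abs, abs_le]
    constructor <;> linarith [hg0 y, hg1 y]
  set I := ∫ y in B, (1 - g y) ∂μ with hI
  have key : ∀ n : ℕ, 0 < n →
      Real.exp (-(I + μ.real B / n)) ≤ P.real {ω | ∀ i, X i ω ∈ B → H i ω < f (X i ω)} ∧
      P.real {ω | ∀ i, X i ω ∈ B → H i ω < f (X i ω)} ≤ Real.exp (-(I - μ.real B / n)) := by
    intro n hn
    have hn' : (0 : ℝ) < n := by exact_mod_cast hn
    set C : Fin (n + 1) → Set E := fun j => B ∩ {y | ⌊n * g y⌋₊ = j} with hCdef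
    have hCm : ∀ j, MeasurableSet (C j) := fun j =>
      hB.inter (((hgm.const_mul (n : ℝ)).nat_floor) (measurableSet_singleton (j : ℕ)))
    have hCB : ∀ j, C j ⊆ B := fun j => Set.inter_subset_left
    have hμC : ∀ j, μ (C j) ≠ ∞ := fun j => measure_ne_top_of_subset (hCB j) hμB
    have hdisj : Pairwise fun j k => Disjoint (C j) (C k) := by
      intro j k hjk
      refine Set.disjoint_left.2 fun y hj hk => hjk (Fin.ext ?_)
      exact hj.2.symm.trans hk.2
    have hC : B = ⋃ j, C j := by
      refine Set.Subset.antisymm (fun y hy => ?_) (Set.iUnion_subset hCB)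
      have hle : ⌊n * g y⌋₊ < n + 1 := by
        refine Nat.lt_succ_of_le (Nat.floor_le_of_le ?_)
        nlinarith [hg1 y]
      exact Set.mem_iUnion.2 ⟨⟨_, hle⟩, hy, rfl⟩
    have hlow : ∀ y, (⌊n * g y⌋₊ : ℝ) / n ≤ g y := by
      intro y
      rw [div_le_iff₀ hn', mul_comm (g y)]
      exact Nat.floor_le (mul_nonneg hn'.le (hg0 y))
    have hupp : ∀ y, g y ≤ ((⌊n * g y⌋₊ : ℝ) + 1) / n := by
      intro y
      rw [le_div_iff₀ hn', mul_comm (g y)]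
      exact (Nat.lt_floor_add_one _).le
    have hIsum : I = ∑ j, ∫ y in C j, (1 - g y) ∂μ := by
      rw [hI, hC]
      refine integral_iUnion_fintype hCm hdisj fun j => ?_
      exact IntegrableOn.mono_set hint (hCB j)
    have hconst : ∀ (j : Fin (n + 1)) (c : ℝ), ∫ _ in C j, c ∂μ = μ.real (C j) * c := by
      intro j c; simp
    have hμsum : μ.real B = ∑ j, μ.real (C j) := by
      conv_lhs => rw [hC]
      exact measureReal_iUnion_fintype hdisj hCm hμC
    have hle1 : I ≤ ∑ j : Fin (n + 1), μ.real (C j) * (1 - (j : ℝ) / n) := by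
      rw [hIsum]
      refine Finset.sum_le_sum fun j _ => ?_
      rw [← hconst]
      refine setIntegral_mono_on (IntegrableOn.mono_set hint (hCB j))
        (integrableOn_const (hμC j)) (hCm j) fun y hy => ?_
      have := hlow y
      rw [show ⌊n * g y⌋₊ = j from hy.2] at this
      linarith
    have hle2 : ∑ j : Fin (n + 1), μ.real (C j) * (1 - ((j : ℝ) + 1) / n) ≤ I := by
      rw [hIsum]
      refine Finset.sum_le_sum fun j _ => ?_
      rw [← hconst]
      refine setIntegral_mono_on (integrableOn_const (hμC j))
        (IntegrableOn.mono_set hint (hCB j)) (hCm j) fun y hy => ?_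
      have := hupp y
      rw [show ⌊n * g y⌋₊ = j from hy.2] at this
      linarith
    have hgap : ∑ j : Fin (n + 1), μ.real (C j) * (1 - (j : ℝ) / n)
        = ∑ j : Fin (n + 1), μ.real (C j) * (1 - ((j : ℝ) + 1) / n) + μ.real B / n := by
      rw [hμsum, Finset.sum_div, ← Finset.sum_add_distrib]
      refine Finset.sum_congr rfl fun j _ => ?_
      ring
    have hprod := measure_forall_mark_lt_eq_lintegral hX.measurable hH hXH hf hB
    -- The conditional probability given the locations, for almost every configuration.
    have hcond : ∀ᵐ ω ∂P, ∃ S : Finset ℕ, (∀ i, i ∈ S ↔ X i ω ∈ B) ∧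
        P {ω' | ∀ i, X i ω ∈ B → H i ω' < f (X i ω)} = ∏ i ∈ S, ENNReal.ofReal (g (X i ω)) := by
      filter_upwards [hX.ae_pointCount_ne_top hB hμB] with ω hω
      have hfin : {i | X i ω ∈ B}.Finite := Set.encard_ne_top_iff.1 hω
      have hS : ∀ i, i ∈ hfin.toFinset ↔ X i ω ∈ B := fun i => by simp
      refine ⟨hfin.toFinset, hS, ?_⟩
      rw [measure_forall_mark_lt_eq_prod hH hH_law hH_indep hS]
      exact Finset.prod_congr rfl fun i _ => hgν _
    constructor
    · refine (ENNReal.ofReal_le_iff_le_toReal (measure_ne_top _ _)).1 ?_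
      calc ENNReal.ofReal (Real.exp (-(I + μ.real B / n)))
          ≤ ENNReal.ofReal (Real.exp (-∑ j : Fin (n + 1), μ.real (C j) * (1 - (j : ℝ) / n))) :=
            ENNReal.ofReal_le_ofReal (Real.exp_le_exp.2 (by linarith))
        _ = _ := (hX.lintegral_prod_pow_pointCount hCm hμC hdisj (fun j => by positivity)).symm
        _ ≤ _ := by
            rw [hprod]
            refine lintegral_mono_ae ?_
            filter_upwards [hcond] with ω ⟨S, hS, hω⟩
            rw [hω, ← prod_eq_prod_pow_pointCount hC hdisj _ hS
              (φ := fun i => ENNReal.ofReal ((⌊n * g (X i ω)⌋₊ : ℝ) / n))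
              (fun i j hj => by rw [show ⌊n * g (X i ω)⌋₊ = j from hj.2])]
            exact Finset.prod_le_prod' fun i _ => ENNReal.ofReal_le_ofReal (hlow (X i ω))
    · refine ENNReal.toReal_le_of_le_ofReal (Real.exp_pos _).le ?_
      calc P {ω | ∀ i, X i ω ∈ B → H i ω < f (X i ω)}
          ≤ ∫⁻ ω, ∏ j : Fin (n + 1), ENNReal.ofReal (((j : ℝ) + 1) / n) ^
              (pointCount (fun i => X i ω) (C j)).toNat ∂P := by
            rw [hprod]
            refine lintegral_mono_ae ?_
            filter_upwards [hcond] with ω ⟨S, hS, hω⟩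
            rw [hω, ← prod_eq_prod_pow_pointCount hC hdisj _ hS
              (φ := fun i => ENNReal.ofReal (((⌊n * g (X i ω)⌋₊ : ℝ) + 1) / n))
              (fun i j hj => by rw [show ⌊n * g (X i ω)⌋₊ = j from hj.2])]
            exact Finset.prod_le_prod' fun i _ => ENNReal.ofReal_le_ofReal (hupp (X i ω))
        _ = _ := hX.lintegral_prod_pow_pointCount hCm hμC hdisj (fun j => by positivity)
        _ ≤ ENNReal.ofReal (Real.exp (-(I - μ.real B / n))) :=
            ENNReal.ofReal_le_ofReal (Real.exp_le_exp.2 (by linarith))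
  have hlim : Filter.Tendsto (fun n : ℕ => μ.real B / (n : ℝ)) Filter.atTop (nhds 0) :=
    tendsto_const_div_atTop_nhds_zero_nat _
  refine le_antisymm ?_ ?_
  · refine ge_of_tendsto (f := fun n : ℕ => Real.exp (-(I - μ.real B / n))) (x := Filter.atTop) ?_ ?_
    · simpa [Function.comp_def] using
        (Real.continuous_exp.tendsto _).comp ((tendsto_const_nhds (x := I)).sub hlim).neg
    · filter_upwards [Filter.eventually_gt_atTop 0] with n hn using (key n hn).2
  · refine le_of_tendsto (f := fun n : ℕ => Real.exp (-(I + μ.real B / n))) (x := Filter.atTop) ?_ ?_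
    · simpa [Function.comp_def] using
        (Real.continuous_exp.tendsto _).comp ((tendsto_const_nhds (x := I)).add hlim).neg
    · filter_upwards [Filter.eventually_gt_atTop 0] with n hn using (key n hn).1

end Marks

/-! ### Rayleigh heights and the radial integral -/

theorem intervalIntegrable_lowerIncompleteGamma_half (a b : ℝ) :
    IntervalIntegrable (fun t : ℝ => t ^ ((1 / 2 : ℝ) - 1) * Real.exp (-t)) volume a b :=
  (intervalIntegral.intervalIntegrable_rpow' (by norm_num)).mul_continuousOn (by fun_prop)

theorem continuous_lowerIncompleteGamma_half : Continuous (lowerIncompleteGamma (1 / 2)) :=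
  intervalIntegral.continuous_primitive intervalIntegrable_lowerIncompleteGamma_half 0

/-- The substitution `t = u ^ 2 / γ ^ 2` removes the singularity of the integrand at the origin. -/
theorem hasDerivAt_lowerIncompleteGamma_half_sq {γ u : ℝ} (hγ : 0 < γ) (hu : 0 < u) :
    HasDerivAt (fun v => lowerIncompleteGamma (1 / 2) (v ^ 2 / γ ^ 2))
      (2 / γ * Real.exp (-u ^ 2 / γ ^ 2)) u := by
  have hx : 0 < u ^ 2 / γ ^ 2 := by positivity
  have hcont : ∀ x : ℝ, 0 < x →
      ContinuousAt (fun t : ℝ => t ^ ((1 / 2 : ℝ) - 1) * Real.exp (-t)) x := fun x hx =>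
    (Real.continuousAt_rpow_const _ _ (.inl hx.ne')).mul (by fun_prop)
  have h1 : HasDerivAt (lowerIncompleteGamma (1 / 2))
      ((u ^ 2 / γ ^ 2) ^ ((1 / 2 : ℝ) - 1) * Real.exp (-(u ^ 2 / γ ^ 2))) (u ^ 2 / γ ^ 2) := by
    refine intervalIntegral.integral_hasDerivAt_right
      (intervalIntegrable_lowerIncompleteGamma_half _ _) ?_ (hcont _ hx)
    exact ContinuousAt.stronglyMeasurableAtFilter (s := Set.Ioi 0) isOpen_Ioi
      (fun x hx => hcont x hx) _ hx
  have h2 : HasDerivAt (fun v : ℝ => v ^ 2 / γ ^ 2) (2 * u / γ ^ 2) u := by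
    simpa using (hasDerivAt_pow 2 u).div_const (γ ^ 2)
  have h3 := h1.comp u h2
  convert! h3 using 1
  have : (u ^ 2 / γ ^ 2) ^ ((1 / 2 : ℝ) - 1) = γ / u := by
    rw [← div_pow, ← Real.rpow_natCast (u / γ) 2, ← Real.rpow_mul (by positivity)]
    norm_num
    rw [Real.rpow_neg_one, inv_div]
  rw [this, neg_div]
  field_simp

/-- The radial integral: with `u = hb + r * τ`, the integrand is the `r`-derivative of
`-γ ^ 2 / (2 * τ ^ 2) * exp (-u ^ 2 / γ ^ 2) - hb * γ / (2 * τ ^ 2) * Γ(1 / 2, u ^ 2 / γ ^ 2)`. -/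
theorem integral_mul_exp_neg_affine_sq {γ hb τ R : ℝ} (hγ : 0 < γ) (hhb : 0 ≤ hb) (hτ : 0 < τ)
    (hR : 0 ≤ R) :
    ∫ r in (0 : ℝ)..R, r * Real.exp (-(hb + r * τ) ^ 2 / γ ^ 2)
      = γ / (2 * τ ^ 2) * (γ * (Real.exp (-hb ^ 2 / γ ^ 2) - Real.exp (-(hb + R * τ) ^ 2 / γ ^ 2))
          - hb * (lowerIncompleteGamma (1 / 2) ((hb + R * τ) ^ 2 / γ ^ 2)
            - lowerIncompleteGamma (1 / 2) (hb ^ 2 / γ ^ 2))) := by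
  set G : ℝ → ℝ := fun r => -(γ ^ 2 / (2 * τ ^ 2)) * Real.exp (-(hb + r * τ) ^ 2 / γ ^ 2)
    - hb * γ / (2 * τ ^ 2) * lowerIncompleteGamma (1 / 2) ((hb + r * τ) ^ 2 / γ ^ 2) with hG
  have hcont : Continuous G := by
    have := continuous_lowerIncompleteGamma_half
    fun_prop
  have hderiv : ∀ r ∈ Set.Ioo (0 : ℝ) R,
      HasDerivWithinAt G (r * Real.exp (-(hb + r * τ) ^ 2 / γ ^ 2)) (Set.Ioi r) r := by
    intro r hr
    have hu : 0 < hb + r * τ := by have := mul_pos hr.1 hτ; linarith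
    have h1 : HasDerivAt (fun r : ℝ => hb + r * τ) τ r := by
      simpa using ((hasDerivAt_id r).mul_const τ).const_add hb
    have h2 : HasDerivAt (fun r : ℝ => -(hb + r * τ) ^ 2 / γ ^ 2)
        (-(2 * (hb + r * τ) * τ) / γ ^ 2) r := by
      simpa using (h1.pow 2).neg.div_const (γ ^ 2)
    have h3 := (hasDerivAt_lowerIncompleteGamma_half_sq hγ hu).comp r h1
    have h4 := (h2.exp.const_mul (-(γ ^ 2 / (2 * τ ^ 2)))).sub
      (h3.const_mul (hb * γ / (2 * τ ^ 2)))
    refine (HasDerivAt.congr_deriv h4 ?_).hasDerivWithinAt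
    field_simp
    ring
  rw [intervalIntegral.integral_eq_sub_of_hasDeriv_right_of_le hR hcont.continuousOn hderiv
    (Continuous.intervalIntegrable (by fun_prop) _ _)]
  simp only [hG, zero_mul, add_zero]
  ring

theorem setIntegral_closedBall_fun_norm (f : ℝ → ℝ) {R : ℝ} (hR : 0 ≤ R) :
    ∫ x in Metric.closedBall (0 : Plane) R, f ‖x‖ = 2 * π * ∫ r in (0 : ℝ)..R, r * f r := by
  have h := integral_fun_norm_addHaar (volume : Measure Plane) ((Set.Iic R).indicator f)
  have hball : (volume : Measure Plane).real (Metric.ball 0 1) = π := by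
    simp [Measure.real, Real.pi_nonneg]
  rw [finrank_euclideanSpace_fin, hball] at h
  rw [← integral_indicator measurableSet_closedBall]
  have h1 : ((Metric.closedBall (0 : Plane) R).indicator fun x => f ‖x‖)
      = fun x => (Set.Iic R).indicator f ‖x‖ := by
    ext x; simp [Set.indicator]
  rw [h1, h, intervalIntegral.integral_of_le hR]
  have h2 : ∀ y : ℝ, y ^ (2 - 1) • (Set.Iic R).indicator f y
      = (Set.Iic R).indicator (fun r => r * f r) y := by
    intro y; by_cases hy : y ∈ Set.Iic R <;> simp [hy]
  simp_rw [h2]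
  rw [setIntegral_indicator measurableSet_Iic, Set.Ioi_inter_Iic]
  simp; ring

/-- The tail of the Rayleigh distribution. -/
theorem rayleighMeasure_Ici {γ u : ℝ} (hγ : 0 < γ) (hu : 0 ≤ u) :
    rayleighMeasure (γ / √2) (Set.Ici u) = ENNReal.ofReal (Real.exp (-u ^ 2 / γ ^ 2)) := by
  have hσ : (γ / √2) ^ 2 = γ ^ 2 / 2 := by rw [div_pow, Real.sq_sqrt (by norm_num)]
  have hderiv : ∀ x ∈ Set.Ici u, HasDerivAt (fun x : ℝ => -Real.exp (-x ^ 2 / γ ^ 2))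
      (2 * x / γ ^ 2 * Real.exp (-x ^ 2 / γ ^ 2)) x := by
    intro x _
    have h2 : HasDerivAt (fun x : ℝ => -x ^ 2 / γ ^ 2) (-(2 * x) / γ ^ 2) x := by
      simpa using (hasDerivAt_pow 2 x).neg.div_const (γ ^ 2)
    refine h2.exp.neg.congr_deriv ?_
    ring
  have hpos : ∀ x ∈ Set.Ioi u, 0 ≤ 2 * x / γ ^ 2 * Real.exp (-x ^ 2 / γ ^ 2) := by
    intro x hx
    have : 0 ≤ x := hu.trans (le_of_lt hx)
    positivity
  have htend : Filter.Tendsto (fun x : ℝ => -Real.exp (-x ^ 2 / γ ^ 2)) Filter.atTop (nhds (-0)) := by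
    refine (Real.tendsto_exp_atBot.comp ?_).neg
    simp_rw [neg_div]
    exact Filter.tendsto_neg_atTop_atBot.comp
      ((Filter.tendsto_pow_atTop (by norm_num)).atTop_div_const (by positivity))
  have hint := integrableOn_Ioi_deriv_of_nonneg' hderiv hpos htend
  have hval := integral_Ioi_of_hasDerivAt_of_nonneg' hderiv hpos htend
  rw [rayleighMeasure, withDensity_apply _ measurableSet_Ici, setLIntegral_congr Ioi_ae_eq_Ici.symm]
  rw [setLIntegral_congr_fun (g := fun x => ENNReal.ofReal
    (2 * x / γ ^ 2 * Real.exp (-x ^ 2 / γ ^ 2))) measurableSet_Ioi]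
  · rw [← ofReal_integral_eq_lintegral_ofReal hint
      ((ae_restrict_iff' measurableSet_Ioi).2 (.of_forall hpos)), hval]
    simp
  · intro x hx
    have : 0 ≤ x := hu.trans (le_of_lt hx)
    simp only [this, if_true, hσ]
    congr 2 <;> field_simp

theorem integral_id_rayleighMeasure {γ : ℝ} (hγ : 0 < γ) :
    ∫ u, u ∂(rayleighMeasure (γ / √2)) = √π / 2 * γ := by
  have hσ : (γ / √2) ^ 2 = γ ^ 2 / 2 := by rw [div_pow, Real.sq_sqrt (by norm_num)]
  rw [rayleighMeasure, integral_withDensity_eq_integral_toReal_smul]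
  · have h1 : ∀ u : ℝ, (ENNReal.ofReal (if 0 ≤ u then u / (γ / √2) ^ 2 *
        Real.exp (-u ^ 2 / (2 * (γ / √2) ^ 2)) else 0)).toReal • u
        = (Set.Ici 0).indicator (fun u : ℝ => 2 / γ ^ 2 *
          (u ^ (2 : ℝ) * Real.exp (-(1 / γ ^ 2) * u ^ (2 : ℝ)))) u := by
      intro u
      by_cases hu : 0 ≤ u
      · rw [if_pos hu, ENNReal.toReal_ofReal (by positivity), Set.indicator_of_mem (Set.mem_Ici.2 hu), hσ,
          smul_eq_mul, Real.rpow_two]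
        have : -u ^ 2 / (2 * (γ ^ 2 / 2)) = -(1 / γ ^ 2) * u ^ 2 := by field_simp
        rw [this]
        field_simp
      · rw [if_neg hu, Set.indicator_of_notMem (by simpa using hu)]; simp
    simp_rw [h1]
    rw [integral_indicator measurableSet_Ici, integral_Ici_eq_integral_Ioi, integral_const_mul,
      integral_rpow_mul_exp_neg_mul_rpow (by norm_num) (by norm_num) (by positivity)]
    have hG : Real.Gamma ((2 + 1) / 2) = √π / 2 := by
      rw [show ((2 : ℝ) + 1) / 2 = 1 / 2 + 1 by norm_num, Real.Gamma_add_one (by norm_num),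
        Real.Gamma_one_half_eq]
      ring
    have hp : (1 / γ ^ 2 : ℝ) ^ (-(2 + 1) / 2 : ℝ) = γ ^ 3 := by
      rw [one_div, Real.inv_rpow (by positivity), ← Real.rpow_natCast γ 2,
        ← Real.rpow_mul hγ.le, ← Real.rpow_neg hγ.le, ← Real.rpow_natCast γ 3]
      norm_num
    rw [hG, hp]
    field_simp
  · refine Measurable.ennreal_ofReal (Measurable.ite measurableSet_Ici ?_ measurable_const)
    fun_prop
  · exact .of_forall fun _ => ENNReal.ofReal_lt_top

/-! ### The minimum inclination angle -/

/-- A steeper tether reaches fewer buildings and passes higher above each of them. -/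
theorem IsClearAngle.mono {hb T θ θ' : ℝ} {x : ℕ → Plane} {h : ℕ → ℝ} (hT : 0 ≤ T) (h0 : 0 ≤ θ)
    (hle : θ ≤ θ') (hlt : θ' < π / 2) (hc : IsClearAngle hb T x h θ) :
    IsClearAngle hb T x h θ' := by
  intro i hi
  have hcos : Real.cos θ' ≤ Real.cos θ :=
    Real.cos_le_cos_of_nonneg_of_le_pi h0 (by linarith [Real.pi_pos]) hle
  have htan : Real.tan θ ≤ Real.tan θ' :=
    Real.strictMonoOn_tan.monotoneOn ⟨by linarith [Real.pi_pos], by linarith⟩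
      ⟨by linarith [Real.pi_pos], hlt⟩ hle
  have h1 := hc i (hi.trans (mul_le_mul_of_nonneg_left hcos hT))
  have h2 := mul_le_mul_of_nonneg_left htan (norm_nonneg (x i))
  linarith

theorem bddBelow_clearAngles (hb T : ℝ) (x : ℕ → Plane) (h : ℕ → ℝ) :
    BddBelow (insert (π / 2) {θ | θ ∈ Set.Ico 0 (π / 2) ∧ IsClearAngle hb T x h θ}) := by
  refine ⟨0, ?_⟩
  rintro θ (rfl | hθ)
  · positivity
  · exact hθ.1.1

theorem minInclination_lt_iff {hb T a : ℝ} {x : ℕ → Plane} {h : ℕ → ℝ} :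
    minInclination hb T x h < a ↔
      π / 2 < a ∨ ∃ θ ∈ Set.Ico 0 (π / 2), θ < a ∧ IsClearAngle hb T x h θ := by
  rw [minInclination, csInf_lt_iff (bddBelow_clearAngles hb T x h) (Set.insert_nonempty _ _)]
  constructor
  · rintro ⟨θ, rfl | hθ, hlt⟩
    · exact .inl hlt
    · exact .inr ⟨θ, hθ.1, hlt, hθ.2⟩
  · rintro (hlt | ⟨θ, hθ, hlt, hc⟩)
    · exact ⟨π / 2, .inl rfl, hlt⟩
    · exact ⟨θ, .inr ⟨hθ, hc⟩, hlt⟩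

theorem minInclination_le_of_isClearAngle {hb T θ : ℝ} {x : ℕ → Plane} {h : ℕ → ℝ}
    (hθ : θ ∈ Set.Ico 0 (π / 2)) (hc : IsClearAngle hb T x h θ) :
    minInclination hb T x h ≤ θ :=
  csInf_le (bddBelow_clearAngles hb T x h) (.inr ⟨hθ, hc⟩)

theorem isClearAngle_of_minInclination_lt {hb T θ : ℝ} {x : ℕ → Plane} {h : ℕ → ℝ} (hT : 0 ≤ T)
    (hθ : θ < π / 2) (hlt : minInclination hb T x h < θ) : IsClearAngle hb T x h θ := by
  obtain hlt | ⟨θ₀, hθ₀, hlt, hc⟩ := minInclination_lt_iff.1 hlt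
  · exact absurd hlt (by linarith)
  · exact hc.mono hT hθ₀.1 hlt.le hθ

theorem setOf_isClearAngle {Ω : Type*} {X : ℕ → Ω → Plane} {H : ℕ → Ω → ℝ} (hb T θ : ℝ) :
    {ω | IsClearAngle hb T (fun i => X i ω) (fun i => H i ω) θ}
      = {ω | ∀ i, X i ω ∈ Metric.closedBall 0 (T * Real.cos θ) →
          H i ω < hb + ‖X i ω‖ * Real.tan θ} := by
  simp [IsClearAngle]

section Law

variable {Ω : Type*} [MeasurableSpace Ω] {P : Measure Ω} {X : ℕ → Ω → Plane} {H : ℕ → Ω → ℝ}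

theorem measurableSet_isClearAngle (hX : ∀ i, Measurable (X i)) (hH : ∀ i, Measurable (H i))
    (hb T θ : ℝ) :
    MeasurableSet {ω | IsClearAngle hb T (fun i => X i ω) (fun i => H i ω) θ} := by
  rw [setOf_isClearAngle]
  have hS := measurableSet_forall_mark_lt (f := fun y : Plane => hb + ‖y‖ * Real.tan θ)
    (B := Metric.closedBall 0 (T * Real.cos θ)) (by fun_prop) measurableSet_closedBall
  have hXH : Measurable fun ω => ((fun i => X i ω : ℕ → Plane), (fun i => H i ω : ℕ → ℝ)) :=
    (measurable_pi_lambda _ hX).prodMk (measurable_pi_lambda _ hH)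
  exact hXH hS

/-- By monotonicity of clearness, rational angles suffice to detect `minInclination < a`. -/
theorem measurable_minInclination (hX : ∀ i, Measurable (X i)) (hH : ∀ i, Measurable (H i))
    {hb T : ℝ} (hT : 0 ≤ T) :
    Measurable fun ω => minInclination hb T (fun i => X i ω) (fun i => H i ω) := by
  refine measurable_of_Iio fun a => ?_
  have : (fun ω => minInclination hb T (fun i => X i ω) (fun i => H i ω)) ⁻¹' Set.Iio a
      = {_ω | π / 2 < a} ∪ ⋃ q : ℚ, ⋃ _ : (q : ℝ) ∈ Set.Ico 0 (π / 2) ∧ (q : ℝ) < a,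
          {ω | IsClearAngle hb T (fun i => X i ω) (fun i => H i ω) q} := by
    ext ω
    simp only [Set.mem_preimage, Set.mem_Iio, minInclination_lt_iff, Set.mem_union,
      Set.mem_ofPred_eq, Set.mem_iUnion, exists_prop]
    refine or_congr_right ⟨?_, ?_⟩
    · rintro ⟨θ, hθ, hlt, hc⟩
      obtain ⟨q, hq1, hq2⟩ := exists_rat_btwn (lt_min hθ.2 hlt)
      exact ⟨q, ⟨⟨hθ.1.trans hq1.le, hq2.trans_le (min_le_left _ _)⟩,
        hq2.trans_le (min_le_right _ _)⟩,
        hc.mono hT hθ.1 hq1.le (hq2.trans_le (min_le_left _ _))⟩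
    · rintro ⟨q, ⟨hq, hqa⟩, hc⟩
      exact ⟨q, hq, hqa, hc⟩
  rw [this]
  exact (MeasurableSet.const _).union
    (.iUnion fun q => .iUnion fun _ => measurableSet_isClearAngle hX hH hb T q)

/-- The closed form of the distribution function of the minimum inclination angle, meant for
`0 < θ < π / 2`. -/
noncomputable def inclinationCDF (β γ hb T θ : ℝ) : ℝ :=
  Real.exp (-(π * β * γ) / Real.tan θ ^ 2 *
    (γ * (Real.exp (-hb ^ 2 / γ ^ 2) - Real.exp (-(hb + T * Real.sin θ) ^ 2 / γ ^ 2))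
      - hb * (lowerIncompleteGamma (1 / 2) ((hb + T * Real.sin θ) ^ 2 / γ ^ 2)
        - lowerIncompleteGamma (1 / 2) (hb ^ 2 / γ ^ 2))))

theorem continuousAt_inclinationCDF (β γ hb T : ℝ) {θ : ℝ} (hθ : θ ∈ Set.Ioo 0 (π / 2)) :
    ContinuousAt (inclinationCDF β γ hb T) θ := by
  have htan : Real.tan θ ≠ 0 := (Real.tan_pos_of_pos_of_lt_pi_div_two hθ.1 hθ.2).ne'
  have hcos : Real.cos θ ≠ 0 :=
    (Real.cos_pos_of_mem_Ioo ⟨by linarith [hθ.1, Real.pi_pos], hθ.2⟩).ne'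
  have htc : ContinuousAt Real.tan θ := Real.continuousAt_tan.2 hcos
  have hΓ := continuous_lowerIncompleteGamma_half
  refine Real.continuous_exp.continuousAt.comp (ContinuousAt.mul ?_ ?_)
  · exact continuousAt_const.div (htc.pow 2) (pow_ne_zero 2 htan)
  · exact Continuous.continuousAt (by fun_prop)

/-- The probability that an angle is clear: a void probability of the process of the buildings that
are too high, whose intensity is integrated in polar coordinates. -/
theorem measureReal_isClearAngle [IsProbabilityMeasure P] {β γ hb T : ℝ} (hβ : 0 < β) (hγ : 0 < γ)
    (hhb : 0 ≤ hb) (hT : 0 ≤ T)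
    (hX : IsPoissonPointProcess P (ENNReal.ofReal β • (volume : Measure Plane)) X)
    (hH : ∀ i, Measurable (H i)) (hH_law : ∀ i, P.map (H i) = rayleighMeasure (γ / √2))
    (hH_indep : iIndepFun H P) (hXH : IndepFun (fun ω i => X i ω) (fun ω i => H i ω) P)
    {θ : ℝ} (hθ : θ ∈ Set.Ioo 0 (π / 2)) :
    P.real {ω | IsClearAngle hb T (fun i => X i ω) (fun i => H i ω) θ}
      = inclinationCDF β γ hb T θ := by
  have hprob : IsProbabilityMeasure (rayleighMeasure (γ / √2)) :=
    hH_law 0 ▸ Measure.isProbabilityMeasure_map (hH 0).aemeasurable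
  have htan : 0 < Real.tan θ := Real.tan_pos_of_pos_of_lt_pi_div_two hθ.1 hθ.2
  have hcos : 0 < Real.cos θ :=
    Real.cos_pos_of_mem_Ioo ⟨by linarith [hθ.1, Real.pi_pos], hθ.2⟩
  have hR : 0 ≤ T * Real.cos θ := mul_nonneg hT hcos.le
  have hvol : (ENNReal.ofReal β • (volume : Measure Plane))
      (Metric.closedBall 0 (T * Real.cos θ)) ≠ ∞ := by
    rw [Measure.smul_apply, smul_eq_mul]
    exact ENNReal.mul_ne_top ENNReal.ofReal_ne_top measure_closedBall_lt_top.ne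
  have htail : ∀ y : Plane, 1 - (rayleighMeasure (γ / √2)).real (Set.Iio (hb + ‖y‖ * Real.tan θ))
      = Real.exp (-(hb + ‖y‖ * Real.tan θ) ^ 2 / γ ^ 2) := by
    intro y
    rw [← probReal_compl_eq_one_sub measurableSet_Iio, Set.compl_Iio, Measure.real,
      rayleighMeasure_Ici hγ (by positivity), ENNReal.toReal_ofReal (Real.exp_pos _).le]
  rw [setOf_isClearAngle, hX.measureReal_forall_mark_lt hH hH_law hH_indep hXH
    (f := fun y : Plane => hb + ‖y‖ * Real.tan θ) (by fun_prop) measurableSet_closedBall hvol,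
    inclinationCDF]
  simp_rw [htail]
  rw [Measure.restrict_smul, integral_smul_measure, ENNReal.toReal_ofReal hβ.le, smul_eq_mul,
    setIntegral_closedBall_fun_norm (fun r => Real.exp (-(hb + r * Real.tan θ) ^ 2 / γ ^ 2)) hR,
    integral_mul_exp_neg_affine_sq hγ hhb htan hR, mul_assoc T, mul_comm (Real.cos θ),
    Real.tan_mul_cos hcos.ne']
  congr 1
  field_simp

end Law

end Tether

theorem theorem5 {Ω : Type*} [MeasurableSpace Ω] (P : Measure Ω) [IsProbabilityMeasure P]
    (β γ hb T : ℝ) (hβ : 0 < β) (hγ : 0 < γ) (h_hb : 0 ≤ hb) (hT : 0 ≤ T)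
    -- locations of the buildings: a homogeneous Poisson point process with density `β`
    (X : ℕ → Ω → Tether.Plane)
    (hX : Tether.IsPoissonPointProcess P
      (ENNReal.ofReal β • (volume : Measure Tether.Plane)) X)
    -- heights of the buildings: i.i.d. Rayleigh with `P (H i > u) = exp (-u² / γ²)`, independent
    -- of the locations
    (H : ℕ → Ω → ℝ) (hH : ∀ i, Measurable (H i))
    (hH_law : ∀ i, P.map (H i) = Tether.rayleighMeasure (γ / √2))
    (hH_indep : iIndepFun H P)
    (hXH : IndepFun (fun ω i => X i ω) (fun ω i => H i ω) P) :
    (∀ i, ∫ ω, H i ω ∂P = √π / 2 * γ) ∧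
    Measurable (fun ω => Tether.minInclination hb T (fun i => X i ω) (fun i => H i ω)) ∧
    ∀ θ ∈ Set.Ioo 0 (π / 2),
      P.real {ω | Tether.minInclination hb T (fun i => X i ω) (fun i => H i ω) ≤ θ} =
        Real.exp (-(π * β * γ) / Real.tan θ ^ 2 *
          (γ * (Real.exp (-hb ^ 2 / γ ^ 2)
              - Real.exp (-(hb + T * Real.sin θ) ^ 2 / γ ^ 2))
            - hb * (Tether.lowerIncompleteGamma (1 / 2) ((hb + T * Real.sin θ) ^ 2 / γ ^ 2)
              - Tether.lowerIncompleteGamma (1 / 2) (hb ^ 2 / γ ^ 2)))) := by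
  refine ⟨fun i => ?_, Tether.measurable_minInclination hX.measurable hH hT, fun θ hθ => ?_⟩
  · rw [← Tether.integral_id_rayleighMeasure hγ, ← hH_law i,
      integral_map (hH i).aemeasurable (by fun_prop)]
  · change _ = Tether.inclinationCDF β γ hb T θ
    have hclear := fun {φ : ℝ} (hφ : φ ∈ Set.Ioo 0 (π / 2)) =>
      Tether.measureReal_isClearAngle hβ hγ h_hb hT hX hH hH_law hH_indep hXH hφ
    refine le_antisymm ?_ ?_
    -- The infimum need not be attained, so the upper bound comes from clear angles `φ ↓ θ`.
    · refine ge_of_tendsto (x := nhdsWithin θ (Set.Ioi θ))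
        ((Tether.continuousAt_inclinationCDF β γ hb T hθ).tendsto.mono_left nhdsWithin_le_nhds) ?_
      filter_upwards [Ioo_mem_nhdsGT hθ.2] with φ hφ
      rw [← hclear ⟨hθ.1.trans hφ.1, hφ.2⟩]
      exact measureReal_mono fun ω hω =>
        Tether.isClearAngle_of_minInclination_lt hT hφ.2 (lt_of_le_of_lt hω hφ.1)
    · rw [← hclear hθ]
      exact measureReal_mono fun ω hω =>
        Tether.minInclination_le_of_isClearAngle ⟨hθ.1.le, hθ.2⟩ hω
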